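/- **Theorem 5.3.** Let $\xi=(\xi_j)_{j\ge1}$ and $\eta=(\eta_j)_{j\ge1}$ be nonincreasing sequences of nonnegative real numbers converging to $0$, and suppose that $\sum_{j}\xi_j=\infty$. Then $$\sum_{j=1}^n\xi_j\le\sum_{j=1}^n\eta_j\quad\text{for every } n\ge 1$$ if and only if there is an orthostochastic matrix $Q=(Q_{ij})_{i,j\ge1}$ with $\xi=Q\eta$, i.e. $\xi_i=\sum_{j=1}^\infty Q_{ij}\eta_j$ for every $i\ge1$. Here $Q$ is called orthostochastic if $Q_{ij}=U_{ij}^2$ for all $i,j$, for some orthogonal infinite matrix $U$, that is, an infinite matrix $U=(U_{ij})_{i,j\ge1}$ with real entries such that $UU^{T}=U^{T}U=I$ (equivalently, the matrix, in the standard basis of $\ell^2$, of a unitary operator with real entries). -/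

import Mathlib

/-- The cone of nonnegative nonincreasing real sequences converging to `0`.
Sequences are indexed by `ℕ`, starting at `0`. -/
structure IsNullDecreasing (ξ : ℕ → ℝ) : Prop where
  nonneg : ∀ n, 0 ≤ ξ n
  antitone : Antitone ξ
  tendsto_zero : Filter.Tendsto ξ Filter.atTop (nhds 0)

/-- `Majorizes η ξ`, i.e. `ξ ≺ η`: each partial sum of `ξ` is at most that of `η`. -/
def Majorizes (η ξ : ℕ → ℝ) : Prop :=
  ∀ n : ℕ, ∑ j ∈ Finset.range n, ξ j ≤ ∑ j ∈ Finset.range n, η j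

/-- An infinite real matrix is orthogonal if `U * Uᵀ = 1` and `Uᵀ * U = 1`, where the entries of
the two products are convergent series. (The diagonal entries say that the rows and columns are
unit vectors of `ℓ²`; so these are exactly the matrices with real entries of unitary operators
on `ℓ²`.) -/
structure IsInfOrthogonal (U : Matrix ℕ ℕ ℝ) : Prop where
  mul_transpose : ∀ i j, HasSum (fun k => U i k * U j k) ((1 : Matrix ℕ ℕ ℝ) i j)
  transpose_mul : ∀ i j, HasSum (fun k => U k i * U k j) ((1 : Matrix ℕ ℕ ℝ) i j)

/-- `Q` is orthostochastic: the entrywise square of an infinite orthogonal matrix. -/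
def IsOrthostochastic (Q : Matrix ℕ ℕ ℝ) : Prop :=
  ∃ U : Matrix ℕ ℕ ℝ, IsInfOrthogonal U ∧ ∀ i j, Q i j = U i j ^ 2

/-- `ξ = Q η` for an infinite matrix `Q`: each series `∑ j, Q i j * η j` converges, with sum
`ξ i`. -/
def IsMatrixImage (Q : Matrix ℕ ℕ ℝ) (η ξ : ℕ → ℝ) : Prop :=
  ∀ i, HasSum (fun j => Q i j * η j) (ξ i)

/-!
If `ξ = Q η` with `Q` orthostochastic, the column sums `c j` of the first `n` rows of `Q` lie in
`[0, 1]` and add up to `n`, so `∑ c j * η j` is at most the sum of the `n` largest values of `η`.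

Conversely, suppose `ξ ≺ η`. An orthonormal basis in which the diagonal operator of `η` has the
diagonal `ξ` is built by a chain of plane rotations. One vector is carried along, with value `a`
of the quadratic form. Step `n` selects an index `j` of `η` that was not used before, such that
`ξ n` lies between `a` and `η j`; a rotation in the plane of the carried vector and of the basis
vector `j` splits off a unit vector with value `ξ n`, and the orthogonal complement, with value
`a + η j - ξ n`, is carried on. The vectors split off are orthonormal. A coordinate of the carried
vector can only shrink after its introduction, so they are complete if every index gets used and
`a` becomes arbitrarily small (`tendsto_rotCarry`, `hasSum_rotRow_mul_rotRow_col`).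

It remains to select the indices well. The process keeps the invariant `Admissible`, a form of
majorization of the remaining `ξ` by the carried and the unused values. If `a < ξ n`, the largest
unused value is selected. If `ξ n ≤ a`, the largest unused value that is at most `ξ n` may always
be selected; but where the invariant leaves room for it (`HasSlack`), a value at most `ξ n / 2` is
preferred, which uses up a part of `a`. If `a` stayed away from `0`, or if the largest unused value
were eventually never selected, there would be room at all late steps, and `a` would lose at least
half of every late `ξ n`, which is impossible since `∑ ξ n = ∞`
(`SelectionRun.not_eventually_hasSlack`).
-/

/-! ### Orthostochastic images are majorized -/

theorem majorizes_of_isMatrixImage {ξ η : ℕ → ℝ} (hη : IsNullDecreasing η)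
    {Q : Matrix ℕ ℕ ℝ} (hQ : IsOrthostochastic Q) (h : IsMatrixImage Q η ξ) :
    Majorizes η ξ := by
  obtain ⟨U, hU, hQU⟩ := hQ
  intro n
  have hrow : ∀ i, HasSum (fun j => Q i j) 1 := fun i => by
    simpa [hQU, pow_two] using hU.mul_transpose i i
  have hcol : ∀ j, ∑ i ∈ Finset.range n, Q i j ≤ 1 := fun j => by
    have hj : HasSum (fun i => Q i j) 1 := by simpa [hQU, pow_two] using hU.transpose_mul j j
    exact sum_le_hasSum _ (fun i _ => by rw [hQU]; positivity) hj
  have hnonneg : ∀ j, 0 ≤ ∑ i ∈ Finset.range n, Q i j := fun j =>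
    Finset.sum_nonneg fun i _ => by rw [hQU]; positivity
  have hleft : HasSum (fun j => (∑ i ∈ Finset.range n, Q i j) * (η j - η n))
      (∑ i ∈ Finset.range n, (ξ i - 1 * η n)) := by
    have := hasSum_sum (s := Finset.range n) fun i _ => (h i).sub ((hrow i).mul_right (η n))
    simpa only [Finset.sum_mul, ← mul_sub] using this
  have hright : HasSum (fun j => if j ∈ Finset.range n then η j - η n else 0)
      (∑ j ∈ Finset.range n, (η j - η n)) := by
    rw [← Finset.sum_congr rfl fun j hj => if_pos hj]
    exact hasSum_sum_of_ne_finset_zero fun j hj => if_neg hj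
  -- Subtracting `η n` makes the terms with `j < n` nonnegative and the others nonpositive.
  have hterm : ∀ j, (∑ i ∈ Finset.range n, Q i j) * (η j - η n) ≤
      if j ∈ Finset.range n then η j - η n else 0 := fun j => by
    by_cases hj : j < n
    · have := hη.antitone hj.le
      simp only [Finset.mem_range, hj, if_true]
      nlinarith [hcol j]
    · have := hη.antitone (not_lt.mp hj)
      simp only [Finset.mem_range, hj, if_false]
      exact mul_nonpos_of_nonneg_of_nonpos (hnonneg j) (by linarith)
  simpa [Finset.sum_sub_distrib] using hasSum_le hterm hleft hright

theorem pos_of_antitone_of_not_summable {ξ : ℕ → ℝ} (h0 : ∀ n, 0 ≤ ξ n) (ha : Antitone ξ)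
    (hs : ¬ Summable ξ) (n : ℕ) : 0 < ξ n := by
  refine (h0 n).lt_of_ne fun h => hs ?_
  refine summable_of_ne_finset_zero (s := Finset.range n) fun m hm => ?_
  exact le_antisymm (h ▸ ha (by simpa using hm)) (h0 m)

theorem not_summable_of_majorizes {ξ η : ℕ → ℝ} (hξ : ∀ n, 0 ≤ ξ n) (hη : ∀ n, 0 ≤ η n)
    (hs : ¬ Summable ξ) (h : Majorizes η ξ) : ¬ Summable η := fun hη' =>
  hs <| summable_of_sum_range_le (c := ∑' j, η j) hξ fun n =>
    (h n).trans (sum_le_hasSum _ (fun j _ => hη j) hη'.hasSum)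

/-! ### Chains of plane rotations -/

/-- The quadratic form `diag (a, b)` takes every value between `a` and `b` at a unit vector. -/
theorem exists_rotation {a b t : ℝ} (h : b ≤ t ∧ t ≤ a ∨ a ≤ t ∧ t ≤ b) :
    ∃ p : ℝ × ℝ, p.1 ^ 2 + p.2 ^ 2 = 1 ∧ p.1 ^ 2 * a + p.2 ^ 2 * b = t := by
  rcases eq_or_ne a b with rfl | hab
  · exact ⟨(1, 0), by simp, by simp; rcases h with h | h <;> linarith [h.1, h.2]⟩
  have hab' : a - b ≠ 0 := sub_ne_zero.mpr hab
  have h1 : 0 ≤ (t - b) / (a - b) := by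
    rcases h with h | h
    · exact div_nonneg (by linarith [h.1]) (by linarith [h.1, h.2])
    · exact div_nonneg_of_nonpos (by linarith [h.2]) (by linarith [h.1, h.2])
  have h2 : 0 ≤ (a - t) / (a - b) := by
    rcases h with h | h
    · exact div_nonneg (by linarith [h.2]) (by linarith [h.1, h.2])
    · exact div_nonneg_of_nonpos (by linarith [h.1]) (by linarith [h.1, h.2])
  refine ⟨(√((t - b) / (a - b)), √((a - t) / (a - b))), ?_, ?_⟩ <;>
  · simp only [Real.sq_sqrt h1, Real.sq_sqrt h2]
    field_simp
    ring

/-- The carried vector of the chain of rotations with cosines and sines `p n`: it starts as the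
first basis vector, and the `n`-th rotation, in the plane of the carried vector and the basis
vector `n + 1`, splits off the vector `rotRow p n` and carries on its orthogonal complement. -/
def rotCarry (p : ℕ → ℝ × ℝ) : ℕ → ℕ → ℝ
  | 0 => Pi.single 0 1
  | n + 1 => fun j => -(p n).2 * rotCarry p n j + (p n).1 * (Pi.single (n + 1) 1 : ℕ → ℝ) j

/-- The vector split off by the `n`-th rotation of the chain; these are the rows of the
orthogonal matrix. -/
def rotRow (p : ℕ → ℝ × ℝ) (n j : ℕ) : ℝ :=
  (p n).1 * rotCarry p n j + (p n).2 * (Pi.single (n + 1) 1 : ℕ → ℝ) j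

theorem rotCarry_eq_zero (p : ℕ → ℝ × ℝ) : ∀ {n j : ℕ}, n < j → rotCarry p n j = 0
  | 0, j, h => by simp [rotCarry, h.ne']
  | n + 1, j, h => by
    simp [rotCarry, h.ne', rotCarry_eq_zero p (n := n) (j := j) (by omega)]

theorem rotRow_eq_zero (p : ℕ → ℝ × ℝ) {n j : ℕ} (h : n + 1 < j) : rotRow p n j = 0 := by
  simp [rotRow, h.ne', rotCarry_eq_zero p (n := n) (j := j) (by omega)]

theorem hasSum_mul_single (x : ℕ → ℝ) (n : ℕ) :
    HasSum (fun j => x j * (Pi.single n 1 : ℕ → ℝ) j) (x n) := by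
  convert hasSum_single (f := fun j => x j * (Pi.single n 1 : ℕ → ℝ) j) n fun j hj => ?_ using 1
  · simp
  · simp [hj]

section Weighted

variable {p : ℕ → ℝ × ℝ} (w : ℕ → ℝ)

theorem hasSum_single_sq_mul (n : ℕ) :
    HasSum (fun j => (Pi.single n 1 : ℕ → ℝ) j ^ 2 * w j) (w n) := by
  refine (hasSum_mul_single w n).congr_fun fun j => ?_
  by_cases h : j = n <;> simp [h]

/-- The carried vector and the next basis vector are orthogonal for every diagonal form, their
supports being disjoint; so the form at a combination of them is the combination of its values. -/
theorem hasSum_combination_sq_mul {n : ℕ} {a : ℝ}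
    (h : HasSum (fun j => rotCarry p n j ^ 2 * w j) a) (c s : ℝ) :
    HasSum (fun j => (c * rotCarry p n j + s * (Pi.single (n + 1) 1 : ℕ → ℝ) j) ^ 2 * w j)
      (c ^ 2 * a + s ^ 2 * w (n + 1)) := by
  refine ((h.mul_left (c ^ 2)).add ((hasSum_single_sq_mul w (n + 1)).mul_left (s ^ 2))).congr_fun
    fun j => ?_
  by_cases hj : j = n + 1
  · subst hj
    rw [rotCarry_eq_zero p (Nat.lt_succ_self n)]
    ring
  · simp [hj]
    ring

variable {w} {a ξ : ℕ → ℝ}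

theorem hasSum_rotCarry_sq_mul (h0 : a 0 = w 0) (hp : ∀ n, (p n).1 ^ 2 + (p n).2 ^ 2 = 1)
    (hξ : ∀ n, (p n).1 ^ 2 * a n + (p n).2 ^ 2 * w (n + 1) = ξ n)
    (ha : ∀ n, a (n + 1) = a n + w (n + 1) - ξ n) (n : ℕ) :
    HasSum (fun j => rotCarry p n j ^ 2 * w j) (a n) := by
  induction n with
  | zero => rw [h0]; exact hasSum_single_sq_mul w 0
  | succ n ih =>
    have hval : a (n + 1) = (-(p n).2) ^ 2 * a n + (p n).1 ^ 2 * w (n + 1) := by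
      rw [ha, ← hξ]
      linear_combination (-a n - w (n + 1)) * hp n
    rw [hval]
    exact hasSum_combination_sq_mul w ih _ _

theorem hasSum_rotRow_sq_mul (h0 : a 0 = w 0) (hp : ∀ n, (p n).1 ^ 2 + (p n).2 ^ 2 = 1)
    (hξ : ∀ n, (p n).1 ^ 2 * a n + (p n).2 ^ 2 * w (n + 1) = ξ n)
    (ha : ∀ n, a (n + 1) = a n + w (n + 1) - ξ n) (n : ℕ) :
    HasSum (fun j => rotRow p n j ^ 2 * w j) (ξ n) := by
  rw [← hξ]
  exact hasSum_combination_sq_mul w (hasSum_rotCarry_sq_mul h0 hp hξ ha n) _ _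

end Weighted

section Orthogonality

variable {p : ℕ → ℝ × ℝ}

theorem hasSum_rotCarry_sq (hp : ∀ n, (p n).1 ^ 2 + (p n).2 ^ 2 = 1) (n : ℕ) :
    HasSum (fun j => rotCarry p n j ^ 2) 1 := by
  simpa using hasSum_rotCarry_sq_mul (w := fun _ => 1) (a := fun _ => 1) (ξ := fun _ => 1) rfl hp
    (by simpa using hp) (by simp) n

theorem hasSum_rotRow_sq (hp : ∀ n, (p n).1 ^ 2 + (p n).2 ^ 2 = 1) (n : ℕ) :
    HasSum (fun j => rotRow p n j ^ 2) 1 := by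
  simpa using hasSum_rotRow_sq_mul (w := fun _ => 1) (a := fun _ => 1) (ξ := fun _ => 1) rfl hp
    (by simpa using hp) (by simp) n

theorem hasSum_rotRow_mul_rotCarry (hp : ∀ n, (p n).1 ^ 2 + (p n).2 ^ 2 = 1) {i n : ℕ}
    (h : i < n) : HasSum (fun j => rotRow p i j * rotCarry p n j) 0 := by
  induction n, h using Nat.le_induction with
  | base =>
    -- With `c, s := p i`, carried vector `v` and basis vector `e`, the product is
    -- `-c * s * v ^ 2 + (c ^ 2 - s ^ 2) * v * e + c * s * e ^ 2`.
    have h1 := (hasSum_rotCarry_sq hp i).mul_left (-((p i).1 * (p i).2))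
    have h2 := (hasSum_mul_single (rotCarry p i) (i + 1)).mul_left ((p i).1 ^ 2 - (p i).2 ^ 2)
    have h3 := (hasSum_single_sq_mul (fun _ => 1) (i + 1)).mul_left ((p i).1 * (p i).2)
    rw [rotCarry_eq_zero p (Nat.lt_succ_self i)] at h2
    have h := (h1.add h2).add h3
    rw [mul_zero, add_zero, ← add_mul, neg_add_cancel, zero_mul] at h
    refine h.congr_fun fun j => ?_
    simp only [rotRow, rotCarry]
    ring
  | succ n hn ih =>
    have h1 := ih.mul_left (-(p n).2)
    have h2 := (hasSum_mul_single (rotRow p i) (n + 1)).mul_left (p n).1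
    rw [rotRow_eq_zero p (by omega)] at h2
    have h := h1.add h2
    rw [mul_zero, mul_zero, add_zero] at h
    refine h.congr_fun fun j => ?_
    simp only [rotCarry]
    ring

theorem hasSum_rotRow_mul_rotRow_of_lt (hp : ∀ n, (p n).1 ^ 2 + (p n).2 ^ 2 = 1) {i n : ℕ}
    (h : i < n) : HasSum (fun j => rotRow p i j * rotRow p n j) 0 := by
  have h1 := (hasSum_rotRow_mul_rotCarry hp h).mul_left (p n).1
  have h2 := (hasSum_mul_single (rotRow p i) (n + 1)).mul_left (p n).2
  rw [rotRow_eq_zero p (by omega)] at h2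
  have h := h1.add h2
  rw [mul_zero, mul_zero, add_zero] at h
  refine h.congr_fun fun j => ?_
  simp only [rotRow]
  ring

theorem hasSum_rotRow_mul_rotRow (hp : ∀ n, (p n).1 ^ 2 + (p n).2 ^ 2 = 1) (i n : ℕ) :
    HasSum (fun j => rotRow p i j * rotRow p n j) ((1 : Matrix ℕ ℕ ℝ) i n) := by
  rcases lt_trichotomy i n with h | rfl | h
  · simpa [Matrix.one_apply, h.ne] using hasSum_rotRow_mul_rotRow_of_lt hp h
  · simpa [pow_two] using hasSum_rotRow_sq hp i
  · simpa [Matrix.one_apply, h.ne', mul_comm] using hasSum_rotRow_mul_rotRow_of_lt hp h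

/-- The rows split off by the first `n` rotations, together with the carried vector, resolve the
identity on the first `n + 1` coordinates. -/
theorem sum_rotRow_mul_rotRow (hp : ∀ n, (p n).1 ^ 2 + (p n).2 ^ 2 = 1) (j k n : ℕ) :
    ∑ i ∈ Finset.range n, rotRow p i j * rotRow p i k + rotCarry p n j * rotCarry p n k =
      if j = k ∧ j ≤ n then 1 else 0 := by
  induction n with
  | zero =>
    simp only [Finset.range_zero, Finset.sum_empty, rotCarry, Pi.single_apply]
    split_ifs <;> first | omega | simp
  | succ n ih =>
    have hstep : rotRow p n j * rotRow p n k + rotCarry p (n + 1) j * rotCarry p (n + 1) k =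
        rotCarry p n j * rotCarry p n k +
          (Pi.single (n + 1) 1 : ℕ → ℝ) j * (Pi.single (n + 1) 1 : ℕ → ℝ) k := by
      simp only [rotRow, rotCarry]
      linear_combination (rotCarry p n j * rotCarry p n k +
          (Pi.single (n + 1) 1 : ℕ → ℝ) j * (Pi.single (n + 1) 1 : ℕ → ℝ) k) * hp n
    rw [Finset.sum_range_succ, add_assoc, hstep, ← add_assoc, ih]
    simp only [Pi.single_apply]
    split_ifs <;> first | omega | simp

/-- The rows are complete as soon as the carried vector tends weakly to zero. -/
theorem hasSum_rotRow_mul_rotRow_col (hp : ∀ n, (p n).1 ^ 2 + (p n).2 ^ 2 = 1)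
    (hc : ∀ j, Filter.Tendsto (fun n => rotCarry p n j) Filter.atTop (nhds 0)) (j k : ℕ) :
    HasSum (fun i => rotRow p i j * rotRow p i k) ((1 : Matrix ℕ ℕ ℝ) j k) := by
  have hsq : ∀ j, Summable fun i => rotRow p i j ^ 2 := fun j => by
    refine summable_of_sum_range_le (c := 1) (fun i => sq_nonneg _) fun n => ?_
    have hle : ∑ i ∈ Finset.range n, rotRow p i j * rotRow p i j +
        rotCarry p n j * rotCarry p n j ≤ 1 := by
      rw [sum_rotRow_mul_rotRow hp]
      split_ifs <;> norm_num
    simp only [← pow_two] at hle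
    linarith [sq_nonneg (rotCarry p n j)]
  have hsummable : Summable fun i => rotRow p i j * rotRow p i k := by
    refine Summable.of_norm_bounded ((hsq j).add (hsq k)) fun i => ?_
    rw [Real.norm_eq_abs, abs_le]
    constructor <;> nlinarith [sq_nonneg (rotRow p i j + rotRow p i k),
      sq_nonneg (rotRow p i j - rotRow p i k), sq_nonneg (rotRow p i j), sq_nonneg (rotRow p i k)]
  refine (hsummable.hasSum_iff_tendsto_nat).mpr ?_
  have hlim : Filter.Tendsto
      (fun n => (1 : Matrix ℕ ℕ ℝ) j k - rotCarry p n j * rotCarry p n k) Filter.atTop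
      (nhds ((1 : Matrix ℕ ℕ ℝ) j k - 0 * 0)) := tendsto_const_nhds.sub ((hc j).mul (hc k))
  rw [mul_zero, sub_zero] at hlim
  refine hlim.congr' ?_
  filter_upwards [Filter.eventually_ge_atTop j] with n hn
  rw [sub_eq_iff_eq_add, sum_rotRow_mul_rotRow hp j k n]
  simp [Matrix.one_apply, hn]

/-- A coordinate of the carried vector, once introduced, only shrinks. -/
theorem sq_rotCarry_succ_le (hp : ∀ n, (p n).1 ^ 2 + (p n).2 ^ 2 = 1) {n j : ℕ} (h : j ≤ n) :
    rotCarry p (n + 1) j ^ 2 ≤ rotCarry p n j ^ 2 := by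
  have : rotCarry p (n + 1) j = -(p n).2 * rotCarry p n j := by
    simp [rotCarry, (show j ≠ n + 1 by omega)]
  rw [this, mul_pow, neg_sq]
  exact mul_le_of_le_one_left (sq_nonneg _) (by nlinarith [hp n, sq_nonneg (p n).1])

/-- If a positive diagonal form takes arbitrarily small values at the carried vectors, these tend
weakly to zero. -/
theorem tendsto_rotCarry {w a : ℕ → ℝ} (hw : ∀ j, 0 < w j)
    (hp : ∀ n, (p n).1 ^ 2 + (p n).2 ^ 2 = 1)
    (hv : ∀ n, HasSum (fun j => rotCarry p n j ^ 2 * w j) (a n))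
    (hsmall : ∀ ε > 0, ∀ N, ∃ n ≥ N, a n < ε) (j : ℕ) :
    Filter.Tendsto (fun n => rotCarry p n j) Filter.atTop (nhds 0) := by
  have hsq : Filter.Tendsto (fun n => rotCarry p n j ^ 2) Filter.atTop (nhds 0) := by
    rw [Metric.tendsto_atTop]
    intro ε hε
    obtain ⟨N, hN, haN⟩ := hsmall (ε * w j) (mul_pos hε (hw j)) j
    refine ⟨N, fun n hn => ?_⟩
    have hmono : rotCarry p n j ^ 2 ≤ rotCarry p N j ^ 2 := by
      induction n, hn using Nat.le_induction with
      | base => exact le_rfl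
      | succ n hn ih => exact (sq_rotCarry_succ_le hp (hN.trans hn)).trans ih
    have hle : rotCarry p N j ^ 2 * w j ≤ a N :=
      le_hasSum (hv N) j fun i _ => mul_nonneg (sq_nonneg _) (hw i).le
    rw [Real.dist_eq, sub_zero, abs_of_nonneg (sq_nonneg _)]
    exact hmono.trans_lt (lt_of_mul_lt_mul_right (hle.trans_lt haN) (hw j).le)
  rw [tendsto_zero_iff_abs_tendsto_zero]
  simpa [Function.comp_def, Real.sqrt_sq_eq_abs] using hsq.sqrt

end Orthogonality
/-! ### Deletion of a term from a sequence -/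

/-- The sequence `g` with its `k`-th term deleted. -/
def deleteTerm (g : ℕ → ℕ) (k : ℕ) : ℕ → ℕ := fun m => if m < k then g m else g (m + 1)

theorem deleteTerm_strictMono {g : ℕ → ℕ} (hg : StrictMono g) (k : ℕ) :
    StrictMono (deleteTerm g k) := by
  refine strictMono_nat_of_lt_succ fun m => ?_
  unfold deleteTerm
  split_ifs <;> first | omega | exact hg (by omega)

theorem range_deleteTerm {g : ℕ → ℕ} (hg : StrictMono g) (k : ℕ) :
    Set.range (deleteTerm g k) = Set.range g \ {g k} := by
  ext j
  constructor
  · rintro ⟨m, rfl⟩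
    unfold deleteTerm
    split_ifs with h
    · exact ⟨⟨m, rfl⟩, fun h' => h.ne (hg.injective h')⟩
    · exact ⟨⟨m + 1, rfl⟩, fun h' => by have := hg.injective h'; omega⟩
  · rintro ⟨⟨m, rfl⟩, hm⟩
    have hmk : m ≠ k := fun h => hm (by rw [h]; rfl)
    rcases lt_or_gt_of_ne hmk with h | h
    · exact ⟨m, by simp [deleteTerm, h]⟩
    · refine ⟨m - 1, ?_⟩
      rw [deleteTerm, if_neg (by omega), Nat.sub_add_cancel (by omega)]

theorem sum_deleteTerm_of_le (η : ℕ → ℝ) (g : ℕ → ℕ) {k m : ℕ} (h : m ≤ k) :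
    ∑ i ∈ Finset.range m, η (deleteTerm g k i) = ∑ i ∈ Finset.range m, η (g i) :=
  Finset.sum_congr rfl fun i hi => by
    rw [deleteTerm, if_pos ((Finset.mem_range.mp hi).trans_le h)]

theorem sum_deleteTerm_add (η : ℕ → ℝ) (g : ℕ → ℕ) {k m : ℕ} (h : k ≤ m) :
    ∑ i ∈ Finset.range m, η (deleteTerm g k i) + η (g k) =
      ∑ i ∈ Finset.range (m + 1), η (g i) := by
  induction m, h using Nat.le_induction with
  | base => rw [sum_deleteTerm_of_le η g le_rfl, Finset.sum_range_succ]
  | succ m hm ih =>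
    rw [Finset.sum_range_succ, add_right_comm, ih, Finset.sum_range_succ _ (m + 1)]
    simp [deleteTerm, (show ¬ m < k by omega)]

theorem sum_deleteTerm_add_le {η : ℕ → ℝ} (hη : Antitone η) {g : ℕ → ℕ} (hg : StrictMono g)
    (k m : ℕ) :
    ∑ i ∈ Finset.range m, η (deleteTerm g k i) + η (g k) ≤
      ∑ i ∈ Finset.range (m + 1), η (g i) := by
  rcases le_total k m with h | h
  · exact (sum_deleteTerm_add η g h).le
  · rw [sum_deleteTerm_of_le η g h, Finset.sum_range_succ]
    have := hη (hg.monotone h)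
    linarith

/-! ### The selection rule -/

/-- The invariant of the selection process: `a` is the carried value, `g` enumerates the unused
indices of `η` increasingly, and `ξ n` is the next value to be realized. For every `m`, either
the `m + 1` largest unused values all reach `ξ n`, or the carried value with the `m` largest
unused values has at least the sum of the next `m + 1` values of `ξ`. -/
structure Admissible (ξ η : ℕ → ℝ) (n : ℕ) (a : ℝ) (g : ℕ → ℕ) : Prop where
  nonneg : 0 ≤ a
  strictMono : StrictMono g
  dominates : ∀ m, ξ n ≤ η (g m) ∨
    ∑ i ∈ Finset.range (m + 1), ξ (n + i) ≤ a + ∑ i ∈ Finset.range m, η (g i)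

/-- The condition under which an arbitrarily small value of `η` may be selected: the invariant
for step `n + 1` would hold even if the selected value were zero. -/
def HasSlack (ξ η : ℕ → ℝ) (n : ℕ) (a : ℝ) (g : ℕ → ℕ) : Prop :=
  ∀ m, ξ (n + 1) ≤ η (g m) ∨
    ∑ i ∈ Finset.range (m + 2), ξ (n + i) ≤ a + ∑ i ∈ Finset.range m, η (g i)

/-- What the process demands of the position `k` selected at step `n`. -/
structure Selects (ξ η : ℕ → ℝ) (n : ℕ) (a : ℝ) (g : ℕ → ℕ) (k : ℕ) : Prop where
  between : η (g k) ≤ ξ n ∧ ξ n ≤ a ∨ a ≤ ξ n ∧ ξ n ≤ η (g k)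
  eq_zero : a < ξ n → k = 0
  le_half : ξ n ≤ a → HasSlack ξ η n a g → η (g k) ≤ ξ n / 2

theorem Admissible.exists_selects {ξ η : ℕ → ℝ} (hξpos : ∀ n, 0 < ξ n) (hξ : Antitone ξ)
    (hη : IsNullDecreasing η) {n : ℕ} {a : ℝ} {g : ℕ → ℕ} (h : Admissible ξ η n a g) :
    ∃ k, Selects ξ η n a g k ∧
      Admissible ξ η (n + 1) (a + η (g k) - ξ n) (deleteTerm g k) := by
  have hshift : ∀ m, ∑ i ∈ Finset.range (m + 1), ξ (n + 1 + i) =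
      ∑ i ∈ Finset.range (m + 2), ξ (n + i) - ξ n := fun m => by
    rw [Finset.sum_range_succ' _ (m + 1)]
    simp [add_assoc, add_comm 1]
  -- The positions from the deleted one on are taken care of by the invariant at `m + 1`.
  have hlater : ∀ k m, k ≤ m → ξ (n + 1) ≤ η (deleteTerm g k m) ∨
      ∑ i ∈ Finset.range (m + 1), ξ (n + 1 + i) ≤
        (a + η (g k) - ξ n) + ∑ i ∈ Finset.range m, η (deleteTerm g k i) := by
    intro k m hkm
    have hsum := sum_deleteTerm_add η g hkm
    rcases h.dominates (m + 1) with h1 | h1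
    · left
      rw [deleteTerm, if_neg (by omega)]
      exact (hξ n.le_succ).trans h1
    · right
      rw [hshift]
      linarith
  have hsmall : ∀ ε > 0, ∃ k, η (g k) ≤ ε := fun ε hε => by
    have := (hη.tendsto_zero.comp h.strictMono.tendsto_atTop).eventually (ge_mem_nhds hε)
    exact this.exists
  rcases lt_or_ge a (ξ n) with ha | ha
  · have h0 : ξ n ≤ η (g 0) := (h.dominates 0).resolve_right (by simpa using ha)
    refine ⟨0, ⟨Or.inr ⟨ha.le, h0⟩, fun _ => rfl, fun h' => absurd h' ha.not_ge⟩,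
      by linarith [h.nonneg], deleteTerm_strictMono h.strictMono 0, fun m => hlater 0 m m.zero_le⟩
  by_cases hs : HasSlack ξ η n a g
  · obtain ⟨k, hk⟩ := hsmall (ξ n / 2) (half_pos (hξpos n))
    refine ⟨k, ⟨Or.inl ⟨by linarith [hξpos n], ha⟩, fun h' => absurd h' ha.not_gt, fun _ _ => hk⟩,
      by linarith [hη.nonneg (g k)], deleteTerm_strictMono h.strictMono k, fun m => ?_⟩
    rcases le_or_gt k m with hkm | hkm
    · exact hlater k m hkm
    rcases hs m with h1 | h1
    · left
      rwa [deleteTerm, if_pos hkm]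
    · right
      rw [hshift, sum_deleteTerm_of_le η g hkm.le]
      linarith [hη.nonneg (g k)]
  · classical
    have hex := hsmall (ξ n) (hξpos n)
    have hk := Nat.find_spec hex
    refine ⟨Nat.find hex, ⟨Or.inl ⟨hk, ha⟩, fun h' => absurd h' ha.not_gt,
      fun _ h' => absurd h' hs⟩, by linarith [hη.nonneg (g (Nat.find hex))],
      deleteTerm_strictMono h.strictMono _, fun m => ?_⟩
    rcases le_or_gt (Nat.find hex) m with hkm | hkm
    · exact hlater _ m hkm
    · left
      rw [deleteTerm, if_pos hkm]
      exact (hξ n.le_succ).trans (not_le.mp (Nat.find_min hex hkm)).le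

/-- A run of the selection process: carried values, unused indices and selected positions. -/
structure SelectionRun (ξ η : ℕ → ℝ) (a : ℕ → ℝ) (g : ℕ → ℕ → ℕ) (k : ℕ → ℕ) : Prop where
  carry_zero : a 0 = η 0
  unused_zero : g 0 = Nat.succ
  admissible : ∀ n, Admissible ξ η n (a n) (g n)
  selects : ∀ n, Selects ξ η n (a n) (g n) (k n)
  carry_succ : ∀ n, a (n + 1) = a n + η (g n (k n)) - ξ n
  unused_succ : ∀ n, g (n + 1) = deleteTerm (g n) (k n)

theorem exists_selectionRun {ξ η : ℕ → ℝ} (hξpos : ∀ n, 0 < ξ n) (hξ : Antitone ξ)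
    (hη : IsNullDecreasing η) (h : Majorizes η ξ) : ∃ a g k, SelectionRun ξ η a g k := by
  have h0 : Admissible ξ η 0 (η 0) Nat.succ := by
    refine ⟨hη.nonneg 0, fun _ _ => Nat.succ_lt_succ, fun m => Or.inr ?_⟩
    have := h (m + 1)
    rw [Finset.sum_range_succ' η] at this
    simpa [add_comm (η 0)] using this
  have hstep := fun (n : ℕ) (s : ℝ × (ℕ → ℕ)) (hs : Admissible ξ η n s.1 s.2) =>
    hs.exists_selects hξpos hξ hη
  choose! K hK using hstep
  let s : ℕ → ℝ × (ℕ → ℕ) := fun n => Nat.rec (η 0, Nat.succ)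
    (fun n s => (s.1 + η (s.2 (K n s)) - ξ n, deleteTerm s.2 (K n s))) n
  have hs : ∀ n, Admissible ξ η n (s n).1 (s n).2 := fun n => by
    induction n with
    | zero => exact h0
    | succ n ih => exact (hK n (s n) ih).2
  exact ⟨fun n => (s n).1, fun n => (s n).2, fun n => K n (s n), rfl, rfl, hs,
    fun n => (hK n (s n) (hs n)).1, fun _ => rfl, fun _ => rfl⟩

namespace SelectionRun

variable {ξ η a : ℕ → ℝ} {g : ℕ → ℕ → ℕ} {k : ℕ → ℕ}

/-- Slack cannot persist: the carried value would lose at least half of each `ξ n`. -/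
theorem not_eventually_hasSlack (h : SelectionRun ξ η a g k) (hξ : ∀ n, 0 ≤ ξ n)
    (hsum : ¬ Summable ξ) (N : ℕ) :
    ¬ ∀ n ≥ N, ξ n ≤ a n ∧ HasSlack ξ η n (a n) (g n) := by
  intro hN
  have hdrop : ∀ n ≥ N, a (n + 1) ≤ a n - ξ n / 2 := fun n hn => by
    have := (h.selects n).le_half (hN n hn).1 (hN n hn).2
    rw [h.carry_succ]
    linarith
  have hacc : ∀ m, a (N + m) ≤ a N - (∑ i ∈ Finset.range m, ξ (i + N)) / 2 := fun m => by
    induction m with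
    | zero => simp
    | succ m ih =>
      have := hdrop (N + m) (by omega)
      rw [Finset.sum_range_succ, add_comm m N]
      rw [← add_assoc]
      linarith
  refine hsum ((summable_nat_add_iff N).mp
    (summable_of_sum_range_le (c := 2 * a N) (fun i => hξ _) fun m => ?_))
  linarith [hacc m, (h.admissible (N + m)).nonneg]

/-- The actual future of the carried value bounds from below what it could be with the largest
unused values. -/
theorem sum_add_le (h : SelectionRun ξ η a g k) (hη : Antitone η) (n m r : ℕ) :
    ∑ i ∈ Finset.range m, ξ (n + i) + a (n + m) + ∑ i ∈ Finset.range r, η (g (n + m) i) ≤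
      a n + ∑ i ∈ Finset.range (r + m), η (g n i) := by
  induction m generalizing r with
  | zero => simp
  | succ m ih =>
    have h1 := ih (r + 1)
    have h2 := sum_deleteTerm_add_le hη (h.admissible (n + m)).strictMono (k (n + m)) r
    have h3 := h.carry_succ (n + m)
    rw [← h.unused_succ] at h2
    rw [Finset.sum_range_succ, ← add_assoc n m 1, h3]
    rw [add_right_comm r 1 m, add_assoc r m 1] at h1
    linarith

theorem exists_carry_lt (h : SelectionRun ξ η a g k) (hξ : IsNullDecreasing ξ) (hη : Antitone η)
    (hsum : ¬ Summable ξ) : ∀ ε > 0, ∀ N, ∃ n ≥ N, a n < ε := by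
  intro ε hε N
  by_contra! hN
  obtain ⟨N', hN'⟩ := Filter.eventually_atTop.mp
    (hξ.tendsto_zero.eventually (ge_mem_nhds (half_pos hε)))
  refine h.not_eventually_hasSlack hξ.nonneg hsum (max N N') fun n hn => ?_
  have hn1 : N ≤ n := (le_max_left _ _).trans hn
  have hn2 : N' ≤ n := (le_max_right _ _).trans hn
  refine ⟨by linarith [hN n hn1, hN' n hn2], fun m => Or.inr ?_⟩
  have h1 := h.sum_add_le hη n m 0
  simp only [Finset.range_zero, Finset.sum_empty, add_zero, zero_add] at h1
  rw [Finset.sum_range_succ, Finset.sum_range_succ]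
  linarith [hN (n + m) (by omega), hN' (n + m) (by omega), hN' (n + (m + 1)) (by omega)]

theorem exists_selects_first (h : SelectionRun ξ η a g k) (hξ : IsNullDecreasing ξ)
    (hη : Antitone η) (hηpos : ∀ n, 0 < η n) (hsum : ¬ Summable ξ) (N : ℕ) :
    ∃ n ≥ N, k n = 0 := by
  by_contra! hN
  have hfirst : ∀ n ≥ N, g n 0 = g N 0 := fun n hn => by
    induction n, hn using Nat.le_induction with
    | base => rfl
    | succ n hn ih => rw [h.unused_succ, deleteTerm, if_pos (Nat.pos_of_ne_zero (hN n hn)), ih]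
  -- The first unused value `φ` is then never spent, and is large compared with late values of `ξ`.
  set φ := η (g N 0) with hφ
  have hφpos : 0 < φ := hηpos _
  obtain ⟨N', hN'⟩ := Filter.eventually_atTop.mp
    (hξ.tendsto_zero.eventually (ge_mem_nhds (show (0 : ℝ) < φ / 3 by positivity)))
  refine h.not_eventually_hasSlack hξ.nonneg hsum (max N N') fun n hn => ?_
  have hn1 : N ≤ n := (le_max_left _ _).trans hn
  have hn2 : N' ≤ n := (le_max_right _ _).trans hn
  refine ⟨not_lt.mp fun hlt => hN n hn1 ((h.selects n).eq_zero hlt), fun m => ?_⟩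
  cases m with
  | zero =>
    left
    rw [hfirst n hn1]
    linarith [hN' (n + 1) (by omega)]
  | succ m =>
    right
    have h1 := h.sum_add_le hη n m 1
    simp only [Finset.range_one, Finset.sum_singleton] at h1
    rw [hfirst (n + m) (by omega), add_comm 1 m] at h1
    rw [Finset.sum_range_succ, Finset.sum_range_succ, Finset.sum_range_succ]
    linarith [(h.admissible (n + m)).nonneg, hN' (n + m) (by omega), hN' (n + (m + 1)) (by omega),
      hN' (n + (m + 1 + 1)) (by omega)]

theorem range_unused_succ (h : SelectionRun ξ η a g k) (n : ℕ) :
    Set.range (g (n + 1)) = Set.range (g n) \ {g n (k n)} := by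
  rw [h.unused_succ, range_deleteTerm (h.admissible n).strictMono]

theorem range_unused_antitone (h : SelectionRun ξ η a g k) :
    Antitone fun n => Set.range (g n) :=
  antitone_nat_of_succ_le fun n => by rw [h.range_unused_succ]; exact Set.sdiff_subset

/-- The order in which the process uses the indices of `η`. -/
def order (g : ℕ → ℕ → ℕ) (k : ℕ → ℕ) : ℕ → ℕ
  | 0 => 0
  | n + 1 => g n (k n)

theorem order_injective (h : SelectionRun ξ η a g k) : Function.Injective (order g k) := by
  have hne : ∀ n, g n (k n) ≠ 0 := fun n => by
    have : g n (k n) ∈ Set.range (g 0) := h.range_unused_antitone n.zero_le ⟨_, rfl⟩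
    obtain ⟨m, hm⟩ := this
    rw [← hm, h.unused_zero]
    exact Nat.succ_ne_zero m
  have hlt : ∀ n m, n < m → g n (k n) ≠ g m (k m) := fun n m hnm heq => by
    have : g m (k m) ∈ Set.range (g (n + 1)) := h.range_unused_antitone hnm ⟨_, rfl⟩
    rw [h.range_unused_succ] at this
    exact this.2 heq.symm
  rintro (_ | n) (_ | m) hnm
  · rfl
  · exact absurd hnm.symm (hne m)
  · exact absurd hnm (hne n)
  · rcases lt_trichotomy n m with h1 | h1 | h1
    · exact absurd hnm (hlt n m h1)
    · rw [h1]
    · exact absurd hnm.symm (hlt m n h1)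

theorem order_surjective (h : SelectionRun ξ η a g k) (hfirst : ∀ N, ∃ n ≥ N, k n = 0) :
    Function.Surjective (order g k) := by
  intro j
  by_contra! hj
  have hmem : ∀ n, j ∈ Set.range (g n) := fun n => by
    induction n with
    | zero =>
      rw [h.unused_zero]
      exact ⟨j - 1, Nat.succ_pred_eq_of_ne_zero (hj 0).symm⟩
    | succ n ih =>
      rw [h.range_unused_succ]
      exact ⟨ih, fun h' => hj (n + 1) h'.symm⟩
  have hle : ∀ n, g n 0 ≤ j := fun n => by
    obtain ⟨m, hm⟩ := hmem n
    rw [← hm]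
    exact (h.admissible n).strictMono.monotone m.zero_le
  have hmono : Monotone fun n => g n 0 := monotone_nat_of_le_succ fun n => by
    rw [h.unused_succ, deleteTerm]
    split_ifs <;> exact (h.admissible n).strictMono.monotone (by omega)
  have hunb : ∀ B, ∃ n, B ≤ g n 0 := fun B => by
    induction B with
    | zero => exact ⟨0, Nat.zero_le _⟩
    | succ B ih =>
      obtain ⟨n, hn⟩ := ih
      obtain ⟨m, hm, hk⟩ := hfirst n
      refine ⟨m + 1, ?_⟩
      rw [h.unused_succ, deleteTerm, hk, if_neg (lt_irrefl 0)]
      exact (hn.trans (hmono hm)).trans_lt ((h.admissible m).strictMono Nat.zero_lt_one)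
  obtain ⟨n, hn⟩ := hunb (j + 1)
  have := hle n
  omega

end SelectionRun

/-! ### The equivalence -/

theorem exists_isOrthostochastic_of_majorizes {ξ η : ℕ → ℝ} (hξ : IsNullDecreasing ξ)
    (hη : IsNullDecreasing η) (hsum : ¬ Summable ξ) (h : Majorizes η ξ) :
    ∃ Q : Matrix ℕ ℕ ℝ, IsOrthostochastic Q ∧ IsMatrixImage Q η ξ := by
  have hξpos := pos_of_antitone_of_not_summable hξ.nonneg hξ.antitone hsum
  have hηpos := pos_of_antitone_of_not_summable hη.nonneg hη.antitone
    (not_summable_of_majorizes hξ.nonneg hη.nonneg hsum h)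
  obtain ⟨a, g, k, hrun⟩ := exists_selectionRun hξpos hξ.antitone hη h
  let σ : ℕ ≃ ℕ := Equiv.ofBijective (SelectionRun.order g k) ⟨hrun.order_injective,
    hrun.order_surjective (hrun.exists_selects_first hξ hη.antitone hηpos hsum)⟩
  choose p hp hpξ using fun n => exists_rotation (hrun.selects n).between
  have hv := hasSum_rotCarry_sq_mul (w := η ∘ σ) (a := a) hrun.carry_zero hp hpξ hrun.carry_succ
  have hrow := hasSum_rotRow_sq_mul (w := η ∘ σ) (a := a) hrun.carry_zero hp hpξ hrun.carry_succ
  have hc := tendsto_rotCarry (fun j => hηpos (σ j)) hp hv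
    (hrun.exists_carry_lt hξ hη.antitone hsum)
  refine ⟨fun i j => rotRow p i (σ.symm j) ^ 2, ⟨fun i j => rotRow p i (σ.symm j),
    ⟨fun i j => ?_, fun i j => ?_⟩, fun _ _ => rfl⟩, fun i => ?_⟩
  · exact σ.symm.hasSum_iff.mpr (hasSum_rotRow_mul_rotRow hp i j)
  · have := hasSum_rotRow_mul_rotRow_col hp hc (σ.symm i) (σ.symm j)
    simpa [Matrix.one_apply] using this
  · refine σ.hasSum_iff.mp ?_
    simpa [Function.comp_def] using hrow i

theorem theorem5p3 (ξ η : ℕ → ℝ) (hξ : IsNullDecreasing ξ) (hη : IsNullDecreasing η)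
    (hsum : ¬ Summable ξ) :
    Majorizes η ξ ↔ ∃ Q : Matrix ℕ ℕ ℝ, IsOrthostochastic Q ∧ IsMatrixImage Q η ξ :=
  ⟨exists_isOrthostochastic_of_majorizes hξ hη hsum,
    fun ⟨_, hQ, h⟩ => majorizes_of_isMatrixImage hη hQ h⟩
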